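/- **Notation.** Write $e(x)=e^{2\pi i x}$. For integers $r,s\ge 2$ write $r\sim s$ if $r^k=s^l$ for some positive integers $k,l$. For strings $z,w$ over $\{0,\dots,b-1\}$ let $N(z,w)$ be the number of (possibly overlapping) occurrences of $z$ in $w$, and let $w_1^n$ be the prefix of $w$ of length $n$. *Low discrepancy strings.* For each base $b$ let $C_b$ be a real constant and $N_b$ a threshold for it: for every $n'>N_b$, all but at most $\frac12 b^{n'}$ of the strings $w$ of length $n'$ over $\{0,\dots,b-1\}$ satisfy $$\Bigl|\frac{N(z,w_1^n)}{n}-b^{-|z|}\Bigr|<C_b\frac{\sqrt{\log\log n}}{\sqrt n}\qquad\text{for all strings } z \text{ with } |z|\le n'-N_b \text{ and all } N_b\le n\le n'-|z|.\tag{1}$$ (Put $N_b=\infty$ if there is no such number for $C_b$.) Let $\mathcal G_b^{n'}$ be the set of strings of length $n'$ over $\{0,\dots,b-1\}$ that satisfy (1). *The sequences.* Let $u(1),u(2),\dots$ be integers $\ge 2$ and let $p:\mathbb N\to\mathbb N$ satisfy $1\le p(u(m))\le u(m)$ for all $m\ge1$. For $m \geq 1$ put $\langle m\rangle=\lceil e^{\sqrt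 m}+2u(1)m^3\rceil$, $\langle m;r\rangle=\lceil\langle m\rangle/\log r\rceil$, $a_m=\langle m;u(m)\rangle$, $b_m=\langle m+1;u(m)\rangle$. Let $f_n(x)=\bigl|\frac{\sin(n\pi x)}{n\sin(\pi x)}\bigr|$, extended continuously by $f_n(x)=1$ for $x\in\mathbb Z$. For bases $r\not\sim s$ let $\alpha(r,s)=\alpha(s,r)$ be the largest $a\in[0,\frac12]$ such that $$\sum_{n=0}^{M-1}\prod_{i=K+1}^{\infty}f_{p(s)}\bigl(r^n\ell/s^i\bigr)\le 2M^{1-a}\qquad\text{for all natural numbers } M,K,\ell\text{ with }\ell\ge s^K,$$ and the same holds with $r$ and $s$ interchanged. Let $$\beta_m=\min\bigl(\{\alpha(u(i),u(j)):1\le i\le j\le m,\ u(i)\not\sim u(j)\}\cup\{\tfrac12\}\bigr).$$ The sequence $u$ is *good* if 1. $\prod_{i=b_m-1}^{\infty} f_{p(u(m))}(2^{-(i+1)})\ge\prod_{i=1}^{\infty}|\cos(\pi/2^{i+1})|$ for every $m>1$; 2. $\beta_m\ge\beta_1 m^{-1/4}$ for every $m\ge1$; 3. $u(m)\le u(1)\,m$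 for every $m\ge1$; 4. for every $m\ge1$, if $u(m')\ne u(m)$ for some $1\le m'<m$, then $b_m-a_m\ge\max\{N_{u(m)},N_{p(u(m))}\}$. *The choice of $\xi_m$.* Let $$A_m(x)=\sum_{\substack{t=-m\\t\ne0}}^{m}\ \sum_{\substack{h=1\\u(h)\not\sim u(m)}}^{m}\Bigl|\sum_{j=\langle m;u(h)\rangle+1}^{\langle m+1;u(h)\rangle}e\bigl(u(h)^{j-1}tx\bigr)\Bigr|^2 .$$ For $\lambda\ge0$ let $\eta_m(\lambda)=g\,u(m)^{-a_m}$ with $g$ the least non-negative integer such that $g\,u(m)^{-a_m}\ge\lambda$. For $q\le u(m)$ let $\Sigma_m^q(\lambda)$ be the set of numbers $\eta_m(\lambda)+\sum_{i=a_m+1}^{b_m-2}c_iu(m)^{-i}$ with digits $c_i\in\{0,\dots,q-1\}$ whose digit string $c_{a_m+1}\cdots c_{b_m-2}$ lies in $\mathcal G_q^{\,b_m-a_m-2}$. *Criterion 1* at step $m$: $\xi_m$ is an element of $\Sigma_m^{p(u(m))}(\xi_{m-1})$ at which $A_m$ is minimal on that set. *Criterion 2*: the same with $\Sigma_m^{u(m)}(\xi_{m-1})$.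 **Lemma.** Let $u$ be a good sequence of bases $\ge2$, let $\xi_0=0$, and let each $\xi_m$ ($m\ge1$) be chosen according to Criterion 1 or Criterion 2 (the criterion may vary with $m$). Then $\xi_m$ converges to a real number $\xi$, and there is a constant $\delta$ depending only on $u(1)$ such that for every $m\ge1$ $$A_m(\xi)\le\delta\,m^2\,(\langle m+1\rangle-\langle m\rangle)^{2-\beta_m}.$$ -/

import Mathlib

noncomputable section

namespace SchmidtConstruction

/-- Multiplicative equivalence of bases: `r ~ s` iff `r ^ m = s ^ n` for some positive `m`, `n`. -/
def BaseEquiv (r s : ℕ) : Prop :=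
  ∃ m n : ℕ, 0 < m ∧ 0 < n ∧ r ^ m = s ^ n

/-- `e(x) = exp (2 π i x)`. -/
def e (x : ℝ) : ℂ :=
  Complex.exp (2 * Real.pi * Complex.I * x)

/-! ### Low discrepancy strings -/

/-- `N(z, w)`: the number of (sliding) occurrences of the string `z` in the string `w`. -/
def occurrenceCount {b : ℕ} (z w : List (Fin b)) : ℕ :=
  ((Finset.range (w.length + 1 - z.length)).filter
    fun i => (w.drop i).take z.length = z).card

/-- The string `w` over `{0, …, b - 1}` has low discrepancy with constant `C` and threshold `N`:
for every string `z` of length at most `|w| - N` and all `n` with `N ≤ n ≤ |w| - |z|`,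
`|N(z, w₁ … wₙ) / n - b ^ (-|z|)| < C √(log log n) / √n`. -/
def IsLowDiscrepancy {b : ℕ} (C : ℝ) (N : ℕ∞) (w : List (Fin b)) : Prop :=
  ∀ (z : List (Fin b)) (n : ℕ),
    (z.length : ℕ∞) + N ≤ w.length → N ≤ n → n + z.length ≤ w.length →
      |(occurrenceCount z (w.take n) : ℝ) / n - 1 / (b : ℝ) ^ z.length|
        < C * (Real.sqrt (Real.log (Real.log n)) / Real.sqrt n)

/-- For every length `n' > N`, all but at most `ε b ^ n'` of the strings of length `n'` over
`{0, …, b - 1}` have low discrepancy with constant `C` and threshold `N`. -/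
def IsThreshold (b : ℕ) (C ε : ℝ) (N : ℕ) : Prop :=
  ∀ n' : ℕ, N < n' →
    (({w : Fin n' → Fin b | ¬ IsLowDiscrepancy C N (List.ofFn w)}.ncard : ℕ) : ℝ)
      ≤ ε * (b : ℝ) ^ n'

/-- The least threshold belonging to the base `b`, the constant `C` and the exceptional
proportion `ε`; it is `⊤` if there is none. `IsThreshold b C ε` is monotone in `N`, so the
thresholds are exactly the natural numbers that are at least this one. -/
def leastThreshold (b : ℕ) (C ε : ℝ) : ℕ∞ :=
  ⨅ (N : ℕ) (_ : IsThreshold b C ε N), (N : ℕ∞)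

/-! ### The exponents `α(r, s)` -/

/-- The continuous extension to all real `x` of `|sin (n π x) / (n sin (π x))|`
(its value at the integers is `1`). -/
def sineRatio (n : ℕ) (x : ℝ) : ℝ :=
  open Classical in
  if Real.sin (Real.pi * x) = 0 then 1
  else |Real.sin (n * Real.pi * x) / (n * Real.sin (Real.pi * x))|

/-- The sine product bound with exponent `a` for the pair of bases `(r, s)`: for all `N`, `K`
and all `ℓ ≥ s ^ K`,
`∑_{n < N} ∏_{i > K} |sin (p(s) π r ^ n ℓ / s ^ i) / (p(s) sin (π r ^ n ℓ / s ^ i))| ≤ 2 N ^ (1 - a)`.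
All factors lie in `[0, 1]`, so the infinite products converge. -/
def SineBound (p : ℕ → ℕ) (r s : ℕ) (a : ℝ) : Prop :=
  ∀ N K l : ℕ, s ^ K ≤ l →
    ∑ n ∈ Finset.range N,
        ∏' i : ℕ, sineRatio (p s) ((r : ℝ) ^ n * l / (s : ℝ) ^ (K + 1 + i))
      ≤ 2 * (N : ℝ) ^ (1 - a)

/-- `α(r, s)`: the largest exponent in `[0, 1/2]` with which the sine product bound holds for
both `(r, s)` and `(s, r)`; it is symmetric in `r` and `s`. A smaller choice of the exponents
makes the notion of a good sequence more restrictive and the bound on `A_m` weaker. -/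
def alpha (p : ℕ → ℕ) (r s : ℕ) : ℝ :=
  sSup {a : ℝ | 0 ≤ a ∧ a ≤ 1 / 2 ∧ SineBound p r s a ∧ SineBound p s r a}

/-! ### The step lengths. Sequences `u(1), u(2), …` are functions `u : ℕ → ℕ`; `u 0` is not used. -/

/-- `⟨m⟩ = ⌈e ^ √m + 2 u(1) m ^ 3⌉` for `m ≥ 1`, and `⟨0⟩ = 0`. -/
def angle (u : ℕ → ℕ) (m : ℕ) : ℕ :=
  if m = 0 then 0 else ⌈Real.exp (Real.sqrt m) + 2 * (u 1 : ℝ) * (m : ℝ) ^ 3⌉₊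

/-- `⟨m; r⟩ = ⌈⟨m⟩ / log r⌉`. -/
def angleBase (u : ℕ → ℕ) (m r : ℕ) : ℕ :=
  ⌈(angle u m : ℝ) / Real.log r⌉₊

/-- `a_m = ⟨m; u(m)⟩`. -/
def aIdx (u : ℕ → ℕ) (m : ℕ) : ℕ := angleBase u m (u m)

/-- `b_m = ⟨m + 1; u(m)⟩`. -/
def bIdx (u : ℕ → ℕ) (m : ℕ) : ℕ := angleBase u (m + 1) (u m)

/-- `β_m = min ({α(u(i), u(j)) : 1 ≤ i ≤ j ≤ m, u(i) ≁ u(j)} ∪ {1/2})`. -/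
def beta (p u : ℕ → ℕ) (m : ℕ) : ℝ :=
  sInf ({x : ℝ | ∃ i j : ℕ, 1 ≤ i ∧ i ≤ j ∧ j ≤ m ∧ ¬ BaseEquiv (u i) (u j) ∧
    x = alpha p (u i) (u j)} ∪ {1 / 2})

/-- Good sequences, relative to `p` and to the thresholds `N b` (standing for `N_b(1/2)`). -/
structure IsGoodSequence (p : ℕ → ℕ) (N : ℕ → ℕ∞) (u : ℕ → ℕ) : Prop where
  prod_ge : ∀ m : ℕ, 1 < m →
    ∏' i : ℕ, |Real.cos (Real.pi / 2 ^ ((1 + i) + 1))|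
      ≤ ∏' i : ℕ, sineRatio (p (u m)) (1 / 2 ^ ((bIdx u m - 1 + i) + 1))
  beta_ge : ∀ m : ℕ, 1 ≤ m → beta p u 1 * (1 / (m : ℝ) ^ (1 / 4 : ℝ)) ≤ beta p u m
  le_mul : ∀ m : ℕ, 1 ≤ m → u m ≤ u 1 * m
  threshold_le : ∀ m : ℕ, 1 ≤ m → (∃ m' : ℕ, 1 ≤ m' ∧ m' < m ∧ u m' ≠ u m) →
    max (N (u m)) (N (p (u m))) ≤ ((bIdx u m - aIdx u m : ℕ) : ℕ∞)

/-! ### The choice of `ξ_m` -/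

/-- `A_m(x) = ∑_{0 < |t| ≤ m} ∑_{1 ≤ h ≤ m, u(h) ≁ u(m)}
  |∑_{⟨m; u(h)⟩ < j ≤ ⟨m + 1; u(h)⟩} e(u(h) ^ (j - 1) t x)| ^ 2`. -/
def A (u : ℕ → ℕ) (m : ℕ) (x : ℝ) : ℝ :=
  open Classical in
  ∑ t ∈ (Finset.Icc (-(m : ℤ)) m).filter (fun t => t ≠ 0),
    ∑ h ∈ (Finset.Icc 1 m).filter (fun h => ¬ BaseEquiv (u h) (u m)),
      ‖∑ j ∈ Finset.Icc (angleBase u m (u h) + 1) (angleBase u (m + 1) (u h)),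
        e ((u h : ℝ) ^ (j - 1) * t * x)‖ ^ 2

/-- `η_m(y) = g u(m) ^ (-a_m)`, where `g` is the least natural number with
`g u(m) ^ (-a_m) ≥ y`. -/
def eta (u : ℕ → ℕ) (m : ℕ) (y : ℝ) : ℝ :=
  (⌈y * (u m : ℝ) ^ aIdx u m⌉₊ : ℝ) / (u m : ℝ) ^ aIdx u m

/-- The number `η_m(y) + ∑_{i = a_m + 1}^{b_m - 2} c_i u(m) ^ (-i)` with digits `c_i` from
`{0, …, q - 1}`; the digit `c_{a_m + 1 + k}` is `c k`. For `q = u(m)` these numbers form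
`σ_m(y)`, for `q = p(u(m))` they form `σ*_m(y)`. -/
def sigmaPoint (u : ℕ → ℕ) (m : ℕ) (y : ℝ) (q : ℕ)
    (c : Fin (bIdx u m - aIdx u m - 2) → Fin q) : ℝ :=
  eta u m y + ∑ k, ((c k : ℕ) : ℝ) / (u m : ℝ) ^ (aIdx u m + 1 + (k : ℕ))

/-- `x` is a point of `σ_m(y)` (for `q = u(m)`) or of `σ*_m(y)` (for `q = p(u(m))`) whose digit
string has low discrepancy in base `q`, and `A_m(x)` is minimal among all such points. -/
def IsMinimalChoice (u : ℕ → ℕ) (C : ℕ → ℝ) (N : ℕ → ℕ∞) (m : ℕ) (y : ℝ) (q : ℕ) (x : ℝ) :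
    Prop :=
  ∃ c : Fin (bIdx u m - aIdx u m - 2) → Fin q,
    IsLowDiscrepancy (C q) (N q) (List.ofFn c) ∧ x = sigmaPoint u m y q c ∧
    ∀ c' : Fin (bIdx u m - aIdx u m - 2) → Fin q,
      IsLowDiscrepancy (C q) (N q) (List.ofFn c') → A u m x ≤ A u m (sigmaPoint u m y q c')

/-- Criterion 1: the digits are restricted to the `p(u(m))` symbols `0, …, p(u(m)) - 1`. -/
def Criterion1 (p u : ℕ → ℕ) (C : ℕ → ℝ) (N : ℕ → ℕ∞) (m : ℕ) (y x : ℝ) : Prop :=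
  IsMinimalChoice u C N m y (p (u m)) x

/-- Criterion 2: all digits `0, …, u(m) - 1` are allowed. -/
def Criterion2 (u : ℕ → ℕ) (C : ℕ → ℝ) (N : ℕ → ℕ∞) (m : ℕ) (y x : ℝ) : Prop :=
  IsMinimalChoice u C N m y (u m) x

end SchmidtConstruction

end

/-!
Write `s = u(m)`, let `q` be the number of admitted digits, `n` the length of the digit strings and
`G = ⟨m + 1⟩ - ⟨m⟩`. By minimality, `A_m(ξ_m)` is at most the mean of `A_m` over the low
discrepancy strings, hence at most `2 q ^ (-n)` times its sum over all strings. Expanding a square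
in `A_m` and summing over the digits one at a time turns the pair of frequencies `L₁`, `L₂` into a
product of sine ratios at `(L₁ - L₂) / s ^ i`, `i > a_m`. Pairs of exponents at distance `O(m)`, or
within `O(m)` of the upper end of the range, contribute at most `O(m G)`. For each of the others the
finite product is at most twice the infinite one: the discarded factors are evaluated at small,
geometrically decreasing arguments. The sine product bound applied along each diagonal of the double
sum then gives `O(G ^ (2 - β_m))`, and `m G ≤ G ^ (2 - β_m)` because `m ^ 2 ≤ G` and `β_m ≤ 1 / 2`.

Later steps move `ξ_m` by at most `4 exp (-⟨m + 1⟩)`, while the frequencies of each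
exponential sum in `A_m` add up to `O(m exp ⟨m + 1⟩)`; each of these sums therefore changes by
`O(m)`.
-/

namespace SchmidtConstruction

open Finset Filter

open scoped Real Topology

/-! ### The additive character -/

theorem e_eq_fourierChar (x : ℝ) : e x = Real.fourierChar x := by
  rw [e, Real.fourierChar_apply]
  push_cast
  ring_nf

theorem e_add (x y : ℝ) : e (x + y) = e x * e y := by
  simp only [e_eq_fourierChar, AddChar.map_add_eq_mul, Circle.coe_mul]

theorem e_nat_mul (n : ℕ) (x : ℝ) : e (n * x) = e x ^ n := by
  simp only [e_eq_fourierChar, ← nsmul_eq_mul, AddChar.map_nsmul_eq_pow, Circle.coe_pow]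

theorem e_sum {ι : Type*} (s : Finset ι) (f : ι → ℝ) :
    e (∑ i ∈ s, f i) = ∏ i ∈ s, e (f i) := by
  simp only [e, Complex.ofReal_sum, mul_sum, Complex.exp_sum]

theorem norm_e (x : ℝ) : ‖e x‖ = 1 := by
  rw [e_eq_fourierChar, Circle.norm_coe]

theorem conj_e (x : ℝ) : (starRingEnd ℂ) (e x) = e (-x) := by
  rw [e_eq_fourierChar, e_eq_fourierChar, AddChar.map_neg_eq_inv, Circle.coe_inv_eq_conj]

theorem e_eq_exp_I_mul (x : ℝ) : e x = Complex.exp (Complex.I * (2 * π * x : ℝ)) := by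
  rw [e]
  push_cast
  ring_nf

theorem norm_e_sub_one (x : ℝ) : ‖e x - 1‖ = 2 * |Real.sin (π * x)| := by
  rw [e_eq_exp_I_mul, Complex.norm_exp_I_mul_ofReal_sub_one, norm_mul, Real.norm_two,
    Real.norm_eq_abs, mul_assoc, mul_div_cancel_left₀ _ two_ne_zero]

theorem norm_e_sub_e_le (x y : ℝ) : ‖e x - e y‖ ≤ 2 * π * |x - y| := by
  have hfactor : e x - e y = e y * (e (x - y) - 1) := by
    rw [mul_sub, mul_one, ← e_add, add_sub_cancel]
  rw [hfactor, norm_mul, norm_e, one_mul, norm_e_sub_one, mul_assoc,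
    ← abs_of_pos Real.pi_pos, ← abs_mul, abs_of_pos Real.pi_pos]
  exact mul_le_mul_of_nonneg_left Real.abs_sin_le_abs zero_le_two

/-! ### Sine ratios -/

theorem sin_nat_mul_eq_zero {x : ℝ} (n : ℕ) (h : Real.sin (π * x) = 0) :
    Real.sin (n * π * x) = 0 := by
  obtain ⟨k, hk⟩ := Real.sin_eq_zero_iff.1 h
  refine Real.sin_eq_zero_iff.2 ⟨n * k, ?_⟩
  push_cast
  rw [mul_assoc, hk, mul_assoc]

theorem sineRatio_mul (n : ℕ) (x : ℝ) :
    sineRatio n x * (n * |Real.sin (π * x)|) = |Real.sin (n * π * x)| := by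
  rw [sineRatio]
  split_ifs with hsin
  · rw [hsin, sin_nat_mul_eq_zero n hsin, abs_zero, mul_zero, mul_zero]
  · rcases eq_or_ne n 0 with rfl | hn
    · simp
    · rw [abs_div, abs_mul, Nat.abs_cast]
      exact div_mul_cancel₀ _ (mul_ne_zero (Nat.cast_ne_zero.2 hn) (abs_ne_zero.2 hsin))

theorem norm_sum_range_e (q : ℕ) (x : ℝ) :
    ‖∑ c ∈ range q, e (c * x)‖ = q * sineRatio q x := by
  simp only [e_nat_mul]
  by_cases hsin : Real.sin (π * x) = 0
  · have hone : e x = 1 := by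
      rw [← sub_eq_zero, ← norm_eq_zero, norm_e_sub_one, hsin, abs_zero, mul_zero]
    simp [hone, sineRatio, hsin]
  · have hgeom : ‖∑ c ∈ range q, e x ^ c‖ * (2 * |Real.sin (π * x)|) =
        2 * (sineRatio q x * (q * |Real.sin (π * x)|)) := by
      rw [← norm_e_sub_one, ← norm_mul, geom_sum_mul, ← e_nat_mul, norm_e_sub_one, sineRatio_mul,
        mul_left_comm, mul_assoc]
    refine mul_right_cancel₀ (mul_ne_zero two_ne_zero (abs_ne_zero.2 hsin)) (hgeom.trans ?_)
    ring

theorem sineRatio_nonneg (n : ℕ) (x : ℝ) : 0 ≤ sineRatio n x := by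
  rw [sineRatio]
  split_ifs
  exacts [zero_le_one, abs_nonneg _]

theorem sineRatio_le_one (n : ℕ) (x : ℝ) : sineRatio n x ≤ 1 := by
  rcases n.eq_zero_or_pos with rfl | hn
  · rw [sineRatio]
    split_ifs <;> simp
  · have hn' : (0 : ℝ) < n := Nat.cast_pos.2 hn
    refine le_of_mul_le_mul_left ?_ hn'
    calc n * sineRatio n x = ‖∑ c ∈ range n, e (c * x)‖ := (norm_sum_range_e n x).symm
      _ ≤ ∑ c ∈ range n, ‖e (c * x)‖ := norm_sum_le _ _
      _ = n * 1 := by simp only [norm_e, sum_const, card_range, nsmul_eq_mul]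

theorem sineRatio_neg (n : ℕ) (x : ℝ) : sineRatio n (-x) = sineRatio n x := by
  simp [sineRatio]

theorem sineRatio_abs (n : ℕ) (x : ℝ) : sineRatio n |x| = sineRatio n x := by
  rcases abs_choice x with h | h <;> rw [h]
  exact sineRatio_neg n x

theorem one_sub_le_sineRatio {q : ℕ} (hq : q ≠ 0) (x : ℝ) :
    1 - 2 * π * (q * |x|) ≤ sineRatio q x := by
  have hterm : ∀ c ∈ range q, ‖1 - e (c * x)‖ ≤ 2 * π * (q * |x|) := fun c hc => by
    have hcq : (c : ℝ) ≤ q := Nat.cast_le.2 (mem_range.1 hc).le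
    calc ‖1 - e (c * x)‖ = ‖e 0 - e (c * x)‖ := by simp [e]
      _ ≤ 2 * π * |0 - c * x| := norm_e_sub_e_le _ _
      _ = 2 * π * (c * |x|) := by rw [zero_sub, abs_neg, abs_mul, Nat.abs_cast]
      _ ≤ 2 * π * (q * |x|) := by gcongr
  have hdiff : ‖(q : ℂ) - ∑ c ∈ range q, e (c * x)‖ ≤ q * (2 * π * (q * |x|)) := by
    have h := norm_sum_le_of_le _ hterm
    simpa only [sum_sub_distrib, sum_const, card_range, nsmul_eq_mul, mul_one] using h
  have hnorm := norm_sub_norm_le (q : ℂ) (∑ c ∈ range q, e (c * x))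
  rw [norm_sum_range_e, Complex.norm_natCast] at hnorm
  have hq' : (0 : ℝ) < q := Nat.cast_pos.2 (Nat.pos_of_ne_zero hq)
  refine le_of_mul_le_mul_left ?_ hq'
  linarith

/-! ### Products of factors in `[0, 1]` -/

theorem one_sub_sum_le_prod {ι : Type*} {f : ι → ℝ} (h0 : ∀ i, 0 ≤ f i) (h1 : ∀ i, f i ≤ 1)
    (s : Finset ι) : 1 - ∑ i ∈ s, (1 - f i) ≤ ∏ i ∈ s, f i := by
  classical
  induction s using Finset.induction_on with
  | empty => simp
  | insert i s hi ih =>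
    rw [sum_insert hi, prod_insert hi]
    have hprod : ∏ j ∈ s, f j ≤ 1 := prod_le_one (fun j _ => h0 j) fun j _ => h1 j
    nlinarith [mul_nonneg (sub_nonneg.2 (h1 i)) (sub_nonneg.2 hprod)]

theorem tendsto_prod_range_tprod {f : ℕ → ℝ} (h0 : ∀ i, 0 ≤ f i) (h1 : ∀ i, f i ≤ 1) :
    Tendsto (fun n => ∏ i ∈ range n, f i) atTop (𝓝 (∏' i, f i)) := by
  have hanti : Antitone fun s : Finset ℕ => ∏ i ∈ s, f i := fun s t hst =>
    prod_le_prod_of_subset_of_le_one hst (fun i _ => h0 i) fun i _ _ => h1 i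
  have hbdd : BddBelow (Set.range fun s : Finset ℕ => ∏ i ∈ s, f i) :=
    ⟨0, Set.forall_mem_range.2 fun s => prod_nonneg fun i _ => h0 i⟩
  have hmul : Multipliable f := ⟨_, tendsto_atTop_ciInf hanti hbdd⟩
  exact hmul.hasProd.tendsto_prod_nat

theorem tprod_le_prod_range {f : ℕ → ℝ} (h0 : ∀ i, 0 ≤ f i) (h1 : ∀ i, f i ≤ 1) (n : ℕ) :
    ∏' i, f i ≤ ∏ i ∈ range n, f i := by
  have hanti : Antitone fun n => ∏ i ∈ range n, f i := fun m n hmn =>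
    prod_le_prod_of_subset_of_le_one (range_mono hmn) (fun i _ => h0 i) fun i _ _ => h1 i
  exact hanti.le_of_tendsto (tendsto_prod_range_tprod h0 h1) n

theorem half_le_prod_sineRatio {q : ℕ} (hq : q ≠ 0) {s y : ℝ} (hs : 2 ≤ s) (hy : 0 ≤ y)
    (hqy : 32 * (q * y) ≤ 1) (n : ℕ) :
    1 / 2 ≤ ∏ i ∈ range n, sineRatio q (y / s ^ i) := by
  have hdefect : ∀ i ∈ range n, 1 - sineRatio q (y / s ^ i) ≤ 1 / 4 * (1 / 2) ^ i := fun i _ => by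
    have hlow := one_sub_le_sineRatio hq (y / s ^ i)
    calc 1 - sineRatio q (y / s ^ i) ≤ 2 * π * (q * |y / s ^ i|) := by linarith
      _ ≤ 2 * 4 * (q * (y / 2 ^ i)) := by
          rw [abs_of_nonneg (by positivity)]
          gcongr
          exact Real.pi_lt_four.le
      _ = 8 * (q * y) * (1 / 2) ^ i := by
          rw [one_div_pow]
          ring
      _ ≤ 1 / 4 * (1 / 2) ^ i := by
          gcongr
          linarith
  calc (1 / 2 : ℝ) = 1 - 1 / 4 * 2 := by norm_num
    _ ≤ 1 - 1 / 4 * ∑ i ∈ range n, (1 / 2 : ℝ) ^ i := by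
        gcongr
        exact sum_geometric_two_le n
    _ ≤ 1 - ∑ i ∈ range n, (1 - sineRatio q (y / s ^ i)) := by
        rw [mul_sum]
        gcongr with i hi
        exact hdefect i hi
    _ ≤ ∏ i ∈ range n, sineRatio q (y / s ^ i) :=
        one_sub_sum_le_prod (fun _ => sineRatio_nonneg _ _) (fun _ => sineRatio_le_one _ _) _

theorem prod_sineRatio_le_two_mul_tprod {q : ℕ} (hq : q ≠ 0) {s z : ℝ} (hs : 2 ≤ s) (hz : 0 ≤ z)
    (k n : ℕ) (hsmall : 32 * (q * z) ≤ s ^ (k + n)) :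
    ∏ i ∈ range n, sineRatio q (z / s ^ (k + i)) ≤
      2 * ∏' i : ℕ, sineRatio q (z / s ^ (k + i)) := by
  have hlim := tendsto_prod_range_tprod (fun i => sineRatio_nonneg q (z / s ^ (k + i)))
    fun i => sineRatio_le_one q (z / s ^ (k + i))
  rw [← div_le_iff₀' two_pos]
  refine ge_of_tendsto hlim ?_
  filter_upwards [eventually_ge_atTop n] with N hN
  obtain ⟨d, rfl⟩ := Nat.exists_eq_add_of_le hN
  have htail : 1 / 2 ≤ ∏ i ∈ range d, sineRatio q (z / s ^ (k + (n + i))) := by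
    have hy : 32 * (q * (z / s ^ (k + n))) ≤ 1 := by
      rw [← mul_div_assoc, ← mul_div_assoc]
      exact div_le_one_of_le₀ hsmall (by positivity)
    have h := half_le_prod_sineRatio hq hs (by positivity) hy d
    simpa only [div_div, ← pow_add, add_assoc] using h
  rw [prod_range_add, div_eq_mul_one_div]
  exact mul_le_mul_of_nonneg_left htail (prod_nonneg fun _ _ => sineRatio_nonneg _ _)

/-! ### The sine product bound -/

theorem sineBound_zero (p : ℕ → ℕ) (r s : ℕ) : SineBound p r s 0 := by
  intro N K l _
  calc ∑ n ∈ range N, ∏' i : ℕ, sineRatio (p s) ((r : ℝ) ^ n * l / (s : ℝ) ^ (K + 1 + i))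
      ≤ ∑ _n ∈ range N, (1 : ℝ) := sum_le_sum fun n _ => by
        simpa using tprod_le_prod_range (fun i => sineRatio_nonneg (p s) _)
          (fun i => sineRatio_le_one (p s) ((r : ℝ) ^ n * l / (s : ℝ) ^ (K + 1 + i))) 0
    _ = N := by simp
    _ ≤ 2 * (N : ℝ) ^ (1 - 0 : ℝ) := by
        rw [sub_zero, Real.rpow_one]
        linarith [(Nat.cast_nonneg N : (0 : ℝ) ≤ N)]

theorem SineBound.mono {p : ℕ → ℕ} {r s : ℕ} {a b : ℝ} (h : SineBound p r s a) (hba : b ≤ a) :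
    SineBound p r s b := by
  intro N K l hl
  rcases N.eq_zero_or_pos with rfl | hN
  · rw [range_zero, sum_empty]
    positivity
  · refine (h N K l hl).trans (mul_le_mul_of_nonneg_left ?_ zero_le_two)
    exact Real.rpow_le_rpow_of_exponent_le (Nat.one_le_cast.2 hN) (by linarith)

theorem sineBound_of_forall_lt {p : ℕ → ℕ} {r s : ℕ} {a : ℝ} (h : ∀ b < a, SineBound p r s b) :
    SineBound p r s a := by
  intro N K l hl
  rcases N.eq_zero_or_pos with rfl | hN
  · rw [range_zero, sum_empty]
    positivity
  · have hcont : Continuous fun b : ℝ => 2 * (N : ℝ) ^ (1 - b) :=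
      continuous_const.mul ((Real.continuous_const_rpow (Nat.cast_ne_zero.2 hN.ne')).comp
        (continuous_const.sub continuous_id))
    have hlim : Tendsto (fun b : ℝ => 2 * (N : ℝ) ^ (1 - b)) (𝓝[<] a) (𝓝 (2 * (N : ℝ) ^ (1 - a))) :=
      (hcont.tendsto a).mono_left nhdsWithin_le_nhds
    refine ge_of_tendsto hlim ?_
    filter_upwards [self_mem_nhdsWithin] with b hb
    exact h b hb N K l hl

theorem zero_mem_alpha_set (p : ℕ → ℕ) (r s : ℕ) :
    (0 : ℝ) ∈ {a : ℝ | 0 ≤ a ∧ a ≤ 1 / 2 ∧ SineBound p r s a ∧ SineBound p s r a} :=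
  ⟨le_rfl, by norm_num, sineBound_zero p r s, sineBound_zero p s r⟩

theorem alpha_nonneg (p : ℕ → ℕ) (r s : ℕ) : 0 ≤ alpha p r s :=
  le_csSup ⟨1 / 2, fun _ h => h.2.1⟩ (zero_mem_alpha_set p r s)

theorem sineBound_alpha (p : ℕ → ℕ) (r s : ℕ) : SineBound p r s (alpha p r s) := by
  refine sineBound_of_forall_lt fun b hb => ?_
  obtain ⟨a, ⟨-, -, hbound, -⟩, hba⟩ := exists_lt_of_lt_csSup ⟨0, zero_mem_alpha_set p r s⟩ hb
  exact hbound.mono hba.le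

theorem zero_mem_lowerBounds_beta_set (p u : ℕ → ℕ) (m : ℕ) :
    0 ∈ lowerBounds ({x : ℝ | ∃ i j : ℕ, 1 ≤ i ∧ i ≤ j ∧ j ≤ m ∧ ¬ BaseEquiv (u i) (u j) ∧
      x = alpha p (u i) (u j)} ∪ {1 / 2}) := by
  rintro x (⟨i, j, -, -, -, -, rfl⟩ | rfl)
  exacts [alpha_nonneg _ _ _, one_half_pos.le]

theorem beta_nonneg (p u : ℕ → ℕ) (m : ℕ) : 0 ≤ beta p u m :=
  le_csInf ⟨_, Or.inr rfl⟩ (zero_mem_lowerBounds_beta_set p u m)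

theorem beta_le_half (p u : ℕ → ℕ) (m : ℕ) : beta p u m ≤ 1 / 2 :=
  csInf_le ⟨0, zero_mem_lowerBounds_beta_set p u m⟩ (Or.inr rfl)

theorem sineBound_beta (p u : ℕ → ℕ) {m h : ℕ} (h1 : 1 ≤ h) (hm : h ≤ m)
    (hne : ¬ BaseEquiv (u h) (u m)) : SineBound p (u h) (u m) (beta p u m) :=
  (sineBound_alpha p (u h) (u m)).mono
    (csInf_le ⟨0, zero_mem_lowerBounds_beta_set p u m⟩
      (Or.inl ⟨h, m, h1, hm, le_rfl, hne, rfl⟩))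

theorem prod_sineRatio_telescope {s : ℕ} (hs : s ≠ 0) (x : ℝ) (n : ℕ) :
    (∏ i ∈ range n, sineRatio s (x / (s : ℝ) ^ (i + 1))) *
      ((s : ℝ) ^ n * |Real.sin (π * (x / (s : ℝ) ^ n))|) = |Real.sin (π * x)| := by
  have hs' : (s : ℝ) ≠ 0 := Nat.cast_ne_zero.2 hs
  induction n with
  | zero => simp
  | succ n ih =>
    have hstep : sineRatio s (x / (s : ℝ) ^ (n + 1)) *
        (s * |Real.sin (π * (x / (s : ℝ) ^ (n + 1)))|) = |Real.sin (π * (x / (s : ℝ) ^ n))| := by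
      rw [sineRatio_mul]
      congr 2
      rw [pow_succ]
      field_simp [hs']
    rw [← ih, ← hstep, prod_range_succ, pow_succ]
    ring

theorem tprod_sineRatio_self_le {s : ℕ} (hs : 2 ≤ s) {x : ℝ} (hx : 0 < x) :
    ∏' i : ℕ, sineRatio s (x / (s : ℝ) ^ (i + 1)) ≤ 1 / (2 * x) := by
  obtain ⟨n, hn⟩ := pow_unbounded_of_one_lt (2 * x) (Nat.one_lt_cast.2 hs : (1 : ℝ) < s)
  have hsn : (0 : ℝ) < (s : ℝ) ^ n := by positivity
  have hsin : 2 * x ≤ (s : ℝ) ^ n * |Real.sin (π * (x / (s : ℝ) ^ n))| := by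
    have hle : π * (x / (s : ℝ) ^ n) ≤ π / 2 := by
      have hhalf : x / (s : ℝ) ^ n ≤ 1 / 2 := by
        rw [div_le_iff₀ hsn]
        linarith
      rw [div_eq_mul_one_div π 2]
      exact mul_le_mul_of_nonneg_left hhalf Real.pi_pos.le
    calc 2 * x = (s : ℝ) ^ n * (2 / π * (π * (x / (s : ℝ) ^ n))) := by field_simp
      _ ≤ (s : ℝ) ^ n * |Real.sin (π * (x / (s : ℝ) ^ n))| := by
          gcongr
          exact (Real.mul_le_sin (by positivity) hle).trans (le_abs_self _)
  refine (tprod_le_prod_range (fun _ => sineRatio_nonneg _ _)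
    (fun _ => sineRatio_le_one _ _) n).trans ?_
  rw [le_div_iff₀ (by positivity)]
  calc (∏ i ∈ range n, sineRatio s (x / (s : ℝ) ^ (i + 1))) * (2 * x)
      ≤ (∏ i ∈ range n, sineRatio s (x / (s : ℝ) ^ (i + 1))) *
          ((s : ℝ) ^ n * |Real.sin (π * (x / (s : ℝ) ^ n))|) :=
        mul_le_mul_of_nonneg_left hsin (prod_nonneg fun _ _ => sineRatio_nonneg _ _)
    _ = |Real.sin (π * x)| := prod_sineRatio_telescope (by omega) x n
    _ ≤ 1 := Real.abs_sin_le_one _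

theorem sineBound_id {r s : ℕ} (hr : 2 ≤ r) (hs : 2 ≤ s) {a : ℝ} (ha : a ≤ 1) :
    SineBound id r s a := by
  intro N K l hl
  rcases N.eq_zero_or_pos with rfl | hN
  · rw [range_zero, sum_empty]
    positivity
  have hsK : (0 : ℝ) < (s : ℝ) ^ K := by positivity
  have hl' : (s : ℝ) ^ K ≤ l := by exact_mod_cast hl
  have hterm : ∀ n ∈ range N,
      ∏' i : ℕ, sineRatio s ((r : ℝ) ^ n * l / (s : ℝ) ^ (K + 1 + i)) ≤ (1 / 2 : ℝ) ^ n := by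
    intro n _
    have hlarge : (2 : ℝ) ^ n ≤ (r : ℝ) ^ n * l / (s : ℝ) ^ K := by
      rw [le_div_iff₀ hsK]
      gcongr
      exact_mod_cast hr
    have hpos : (0 : ℝ) < (r : ℝ) ^ n * l / (s : ℝ) ^ K :=
      (pow_pos two_pos n).trans_le hlarge
    calc ∏' i : ℕ, sineRatio s ((r : ℝ) ^ n * l / (s : ℝ) ^ (K + 1 + i))
        = ∏' i : ℕ, sineRatio s ((r : ℝ) ^ n * l / (s : ℝ) ^ K / (s : ℝ) ^ (i + 1)) := by
          simp only [div_div, ← pow_add, add_assoc, add_comm 1]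
      _ ≤ 1 / (2 * ((r : ℝ) ^ n * l / (s : ℝ) ^ K)) := tprod_sineRatio_self_le hs hpos
      _ ≤ 1 / 2 ^ n := by
          gcongr
          linarith
      _ = (1 / 2) ^ n := (one_div_pow _ _).symm
  calc ∑ n ∈ range N, ∏' i : ℕ, sineRatio s ((r : ℝ) ^ n * l / (s : ℝ) ^ (K + 1 + i))
      ≤ ∑ n ∈ range N, (1 / 2 : ℝ) ^ n := sum_le_sum hterm
    _ ≤ 2 * 1 := by simpa using sum_geometric_two_le N
    _ ≤ 2 * (N : ℝ) ^ (1 - a) := by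
        gcongr
        exact Real.one_le_rpow (Nat.one_le_cast.2 hN) (by linarith)

/-! ### Double sums along diagonals -/

theorem sum_sum_le_two_mul_diagonals {g : ℕ → ℕ → ℝ} (h0 : ∀ x y, 0 ≤ g x y)
    (hsymm : ∀ x y, g x y = g y x) (R : ℕ) :
    ∑ x ∈ range R, ∑ y ∈ range R, g x y ≤ 2 * ∑ d ∈ range R, ∑ x ∈ range (R - d), g x (x + d) := by
  have hinner : ∀ x, ∑ y ∈ range R, (if x ≤ y then g x y else 0) =
      ∑ d ∈ range (R - x), g x (x + d) := fun x => by
    have hIco : {y ∈ range R | x ≤ y} = Ico x R := by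
      ext y
      simp only [mem_filter, mem_range, mem_Ico, and_comm]
    rw [← sum_filter, hIco, sum_Ico_eq_sum_range]
  have hupper : ∑ x ∈ range R, ∑ y ∈ range R, (if x ≤ y then g x y else 0) =
      ∑ d ∈ range R, ∑ x ∈ range (R - d), g x (x + d) := by
    simp only [hinner]
    exact sum_comm' fun x d => by simp only [mem_range]; omega
  have hlower : ∑ x ∈ range R, ∑ y ∈ range R, (if y ≤ x then g x y else 0) =
      ∑ x ∈ range R, ∑ y ∈ range R, (if x ≤ y then g x y else 0) := by
    rw [sum_comm]
    exact sum_congr rfl fun x _ => sum_congr rfl fun y _ => by rw [hsymm]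
  calc ∑ x ∈ range R, ∑ y ∈ range R, g x y
      ≤ ∑ x ∈ range R, ∑ y ∈ range R,
          ((if x ≤ y then g x y else 0) + if y ≤ x then g x y else 0) := by
        gcongr with x _ y _
        rcases le_total x y with hxy | hxy <;> split_ifs <;> linarith [h0 x y]
    _ = 2 * ∑ d ∈ range R, ∑ x ∈ range (R - d), g x (x + d) := by
        simp only [sum_add_distrib]
        rw [hlower, hupper, two_mul]

theorem sum_sum_le_of_diagonals {g : ℕ → ℕ → ℝ} (h0 : ∀ x y, 0 ≤ g x y) (h1 : ∀ x y, g x y ≤ 1)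
    (hsymm : ∀ x y, g x y = g y x) {R k : ℕ} {B : ℝ} (hB : 0 ≤ B)
    (h : ∀ d, k ≤ d → ∑ x ∈ range (R - d - k), g x (x + d) ≤ B) :
    ∑ x ∈ range R, ∑ y ∈ range R, g x y ≤ 4 * k * R + 2 * R * B := by
  have htrivial : ∀ n c d : ℕ, ∑ x ∈ range n, g (c + x) (c + x + d) ≤ n := fun n c d => by
    simpa using sum_le_card_nsmul (range n) _ 1 fun x _ => h1 (c + x) (c + x + d)
  have hshort : ∀ d, ∑ x ∈ range (R - d), g x (x + d) ≤ R := fun d => by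
    have hle := htrivial (R - d) 0 d
    simp only [zero_add] at hle
    exact hle.trans (Nat.cast_le.2 (Nat.sub_le R d))
  have hlong : ∀ d, k ≤ d → ∑ x ∈ range (R - d), g x (x + d) ≤ k + B := fun d hkd => by
    obtain ⟨c, hc, hsplit⟩ : ∃ c ≤ k, R - d = R - d - k + c := ⟨R - d - (R - d - k), by omega⟩
    rw [hsplit, sum_range_add, add_comm (k : ℝ)]
    exact add_le_add (h d hkd) ((htrivial c _ d).trans (Nat.cast_le.2 hc))
  have hdiag : ∀ d ∈ range R, ∑ x ∈ range (R - d), g x (x + d) ≤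
      (if d ∈ range k then (R : ℝ) else 0) + (k + B) := fun d _ => by
    split_ifs with hdk
    · exact (hshort d).trans (le_add_of_nonneg_right (by positivity))
    · simpa using hlong d (by simpa using hdk)
  have hcount : ∑ d ∈ range R, (if d ∈ range k then (R : ℝ) else 0) ≤ k * R := by
    rw [← sum_filter, filter_mem_eq_inter, sum_const, nsmul_eq_mul]
    gcongr
    exact (card_le_card inter_subset_right).trans (card_range k).le
  calc ∑ x ∈ range R, ∑ y ∈ range R, g x y
      ≤ 2 * ∑ d ∈ range R, ∑ x ∈ range (R - d), g x (x + d) :=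
        sum_sum_le_two_mul_diagonals h0 hsymm R
    _ ≤ 2 * ∑ d ∈ range R, ((if d ∈ range k then (R : ℝ) else 0) + (k + B)) := by
        gcongr with d hd
        exact hdiag d hd
    _ ≤ 2 * (k * R + R * (k + B)) := by
        rw [sum_add_distrib, sum_const, card_range, nsmul_eq_mul]
        gcongr
    _ = 4 * k * R + 2 * R * B := by ring

/-! ### Lacunary sums and their mean squares over digit strings -/

/-- The exponential sum `∑_{A < j ≤ B} e(r ^ (j - 1) t x)`, whose squared modulus is a summand of
`A u m x`. -/
noncomputable def lacunarySum (r A B : ℕ) (t : ℤ) (x : ℝ) : ℂ :=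
  ∑ j ∈ Icc (A + 1) B, e ((r : ℝ) ^ (j - 1) * t * x)

/-- The number `η + ∑_{i = a + 1}^{a + n} c_i s ^ (-i)`; the digit `c_{a + 1 + k}` is `c k`. The
points of `σ_m(y)` and `σ*_m(y)` have this form. -/
noncomputable def digitPoint {n q : ℕ} (s η : ℝ) (a : ℕ) (c : Fin n → Fin q) : ℝ :=
  η + ∑ k, ((c k : ℕ) : ℝ) / s ^ (a + 1 + (k : ℕ))

theorem sum_Icc_succ_eq_sum_range {M : Type*} [AddCommMonoid M] (f : ℕ → M) (A B : ℕ) :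
    ∑ j ∈ Icc (A + 1) B, f (j - 1) = ∑ x ∈ range (B - A), f (A + x) := by
  rw [← Ico_add_one_right_eq_Icc, sum_Ico_eq_sum_range, Nat.add_sub_add_right]
  refine sum_congr rfl fun x _ => congrArg f ?_
  omega

theorem lacunarySum_eq_sum_range (r A B : ℕ) (t : ℤ) (x : ℝ) :
    lacunarySum r A B t x = ∑ i ∈ range (B - A), e ((r : ℝ) ^ (A + i) * t * x) :=
  sum_Icc_succ_eq_sum_range (fun i => e ((r : ℝ) ^ i * t * x)) A B

theorem sum_norm_sum_e_sq_le {ι κ : Type*} [Fintype κ] (J : Finset ι) (ω : ι → ℝ) (x : κ → ℝ) :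
    ∑ c, ‖∑ j ∈ J, e (ω j * x c)‖ ^ 2 ≤ ∑ j ∈ J, ∑ k ∈ J, ‖∑ c, e ((ω j - ω k) * x c)‖ := by
  have hsq : ∀ c, ((‖∑ j ∈ J, e (ω j * x c)‖ : ℝ) : ℂ) ^ 2 =
      ∑ j ∈ J, ∑ k ∈ J, e ((ω j - ω k) * x c) := fun c => by
    rw [← Complex.mul_conj', map_sum, sum_mul_sum]
    simp only [conj_e, ← e_add, ← sub_eq_add_neg, ← sub_mul]
  have hexpand : ((∑ c, ‖∑ j ∈ J, e (ω j * x c)‖ ^ 2 : ℝ) : ℂ) =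
      ∑ j ∈ J, ∑ k ∈ J, ∑ c, e ((ω j - ω k) * x c) := by
    push_cast
    simp only [hsq]
    rw [sum_comm]
    exact sum_congr rfl fun j _ => sum_comm
  calc ∑ c, ‖∑ j ∈ J, e (ω j * x c)‖ ^ 2
      = ‖((∑ c, ‖∑ j ∈ J, e (ω j * x c)‖ ^ 2 : ℝ) : ℂ)‖ := by
        rw [Complex.norm_real, Real.norm_of_nonneg (by positivity)]
    _ ≤ ∑ j ∈ J, ∑ k ∈ J, ‖∑ c, e ((ω j - ω k) * x c)‖ := by
        rw [hexpand]
        exact norm_sum_le_of_le _ fun j _ => norm_sum_le _ _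

theorem norm_sum_e_digitPoint (q : ℕ) (s η L : ℝ) (a n : ℕ) :
    ‖∑ c : Fin n → Fin q, e (L * digitPoint s η a c)‖ =
      (q : ℝ) ^ n * ∏ i ∈ range n, sineRatio q (L / s ^ (a + 1 + i)) := by
  have hterm : ∀ c : Fin n → Fin q, e (L * digitPoint s η a c) =
      e (L * η) * ∏ k : Fin n, e ((c k : ℕ) * (L / s ^ (a + 1 + (k : ℕ)))) := fun c => by
    rw [digitPoint, mul_add, mul_sum, e_add, e_sum]
    simp only [mul_div_left_comm]
  have hdigits : ∑ c : Fin n → Fin q, ∏ k : Fin n, e ((c k : ℕ) * (L / s ^ (a + 1 + (k : ℕ)))) =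
      ∏ k : Fin n, ∑ v ∈ range q, e (v * (L / s ^ (a + 1 + (k : ℕ)))) := by
    rw [← Fintype.prod_sum fun (k : Fin n) (v : Fin q) => e ((v : ℕ) * (L / s ^ (a + 1 + (k : ℕ))))]
    exact prod_congr rfl fun k _ =>
      Fin.sum_univ_eq_sum_range (fun v => e (v * (L / s ^ (a + 1 + (k : ℕ))))) q
  simp only [hterm]
  rw [← mul_sum, hdigits, norm_mul, norm_e, one_mul, norm_prod]
  simp only [norm_sum_range_e]
  rw [prod_mul_distrib, prod_const, card_univ, Fintype.card_fin,
    Fin.prod_univ_eq_prod_range fun i => sineRatio q (L / s ^ (a + 1 + i))]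

theorem abs_frequency_sub {r : ℕ} (hr : 1 ≤ r) (A x d : ℕ) (t : ℤ) :
    |(r : ℝ) ^ (A + x) * t - (r : ℝ) ^ (A + (x + d)) * t| =
      (r : ℝ) ^ x * (r ^ A * t.natAbs * (r ^ d - 1) : ℕ) := by
  have hrd : 1 ≤ r ^ d := Nat.one_le_pow _ _ hr
  have hrd' : (1 : ℝ) ≤ (r : ℝ) ^ d := by exact_mod_cast hrd
  have hfactor : (r : ℝ) ^ (A + x) * t - (r : ℝ) ^ (A + (x + d)) * t =
      -((r : ℝ) ^ (A + x) * t * ((r : ℝ) ^ d - 1)) := by ring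
  rw [hfactor, abs_neg, abs_mul, abs_mul, abs_of_nonneg (sub_nonneg.2 hrd'),
    abs_of_nonneg (by positivity)]
  push_cast [hrd, Nat.cast_natAbs]
  ring

theorem mul_mul_pow_le_pow {q r s t n i j k B : ℕ} (hqs : q ≤ s) (hr : 2 ≤ r)
    (hB : r ^ B ≤ r * s ^ (n + 1)) (hk : 32 * t * s ^ 2 ≤ 2 ^ k) (hij : i ≤ r ^ j * t)
    (hj : j + k < B) : 32 * (q * i) ≤ s ^ n := by
  have hpow : r ^ j * 2 ^ k ≤ s ^ (n + 1) := by
    refine Nat.le_of_mul_le_mul_left ?_ (two_pos.trans_le hr)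
    calc r * (r ^ j * 2 ^ k) ≤ r * (r ^ j * r ^ k) := by gcongr
      _ = r ^ (j + k + 1) := by ring
      _ ≤ r ^ B := Nat.pow_le_pow_right (by omega) hj
      _ ≤ r * s ^ (n + 1) := hB
  refine Nat.le_of_mul_le_mul_right ?_ (pow_pos two_pos k)
  calc 32 * (q * i) * 2 ^ k ≤ 32 * (s * (r ^ j * t)) * 2 ^ k := by gcongr
    _ = 32 * t * s * (r ^ j * 2 ^ k) := by ring
    _ ≤ 32 * t * s * s ^ (n + 1) := by gcongr
    _ = s ^ n * (32 * t * s ^ 2) := by ring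
    _ ≤ s ^ n * 2 ^ k := by gcongr

theorem pow_le_pow_mul_pow_sub_one {r s t a A d : ℕ} (ht : 1 ≤ t) (hA : s ^ a ≤ s * r ^ A)
    (hd : s < r ^ d) : s ^ a ≤ r ^ A * t * (r ^ d - 1) :=
  calc s ^ a ≤ s * r ^ A := hA
    _ = r ^ A * 1 * s := by ring
    _ ≤ r ^ A * t * (r ^ d - 1) := by
      have hsd : s ≤ r ^ d - 1 := Nat.le_sub_one_of_lt hd
      gcongr

theorem sum_diagonal_le {p : ℕ → ℕ} {r s a A B n k d : ℕ} {t : ℤ} {β : ℝ} (hp : p s ≠ 0)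
    (hps : p s ≤ s) (hs : 2 ≤ s) (hr : 2 ≤ r) (hβ : β ≤ 1) (hsine : SineBound p r s β)
    (ht : t ≠ 0) (hA : s ^ a ≤ s * r ^ A) (hB : r ^ B ≤ r * s ^ (a + 2 + n))
    (hk : 32 * t.natAbs * s ^ 2 ≤ 2 ^ k) (hkd : k ≤ d) :
    ∑ x ∈ range (B - A - d - k), ∏ i ∈ range n, sineRatio (p s)
        (((r : ℝ) ^ (A + x) * t - (r : ℝ) ^ (A + (x + d)) * t) / (s : ℝ) ^ (a + 1 + i)) ≤
      4 * ((B - A : ℕ) : ℝ) ^ (1 - β) := by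
  set l : ℕ := r ^ A * t.natAbs * (r ^ d - 1) with hl
  have hlarge : s ^ a ≤ l := by
    have ht' : 1 ≤ t.natAbs := Int.natAbs_pos.2 ht
    have hd : 32 * t.natAbs * s ^ 2 ≤ r ^ d :=
      hk.trans ((Nat.pow_le_pow_right two_pos hkd).trans (Nat.pow_le_pow_left hr d))
    exact pow_le_pow_mul_pow_sub_one ht' hA (by nlinarith)
  have hsmall : ∀ x ∈ range (B - A - d - k),
      32 * (p s * (r ^ x * l)) ≤ s ^ (a + 1 + n) := fun x hx => by
    refine mul_mul_pow_le_pow (j := A + x + d) hps hr (hB.trans_eq (by ring)) hk ?_ ?_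
    · calc r ^ x * l ≤ r ^ x * (r ^ A * t.natAbs * r ^ d) :=
            Nat.mul_le_mul_left _ (Nat.mul_le_mul_left _ (Nat.sub_le _ _))
        _ = r ^ (A + x + d) * t.natAbs := by ring
    · have := mem_range.1 hx
      omega
  calc ∑ x ∈ range (B - A - d - k), ∏ i ∈ range n, sineRatio (p s)
        (((r : ℝ) ^ (A + x) * t - (r : ℝ) ^ (A + (x + d)) * t) / (s : ℝ) ^ (a + 1 + i))
      = ∑ x ∈ range (B - A - d - k), ∏ i ∈ range n,
          sineRatio (p s) ((r : ℝ) ^ x * l / (s : ℝ) ^ (a + 1 + i)) := by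
        refine sum_congr rfl fun x _ => prod_congr rfl fun i _ => ?_
        rw [hl, ← abs_frequency_sub (one_le_two.trans hr), ← sineRatio_abs, abs_div,
          abs_of_pos (by positivity : (0 : ℝ) < (s : ℝ) ^ (a + 1 + i))]
    _ ≤ ∑ x ∈ range (B - A - d - k),
          2 * ∏' i : ℕ, sineRatio (p s) ((r : ℝ) ^ x * l / (s : ℝ) ^ (a + 1 + i)) :=
        sum_le_sum fun x hx => prod_sineRatio_le_two_mul_tprod hp (by exact_mod_cast hs)
          (by positivity) _ _ (by exact_mod_cast hsmall x hx)
    _ ≤ 2 * (2 * ((B - A - d - k : ℕ) : ℝ) ^ (1 - β)) := by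
        rw [← mul_sum]
        exact mul_le_mul_of_nonneg_left (hsine _ a l hlarge) zero_le_two
    _ = 4 * ((B - A - d - k : ℕ) : ℝ) ^ (1 - β) := by ring
    _ ≤ 4 * ((B - A : ℕ) : ℝ) ^ (1 - β) := by
        have hcard : ((B - A - d - k : ℕ) : ℝ) ≤ (B - A : ℕ) := Nat.cast_le.2 (by omega)
        exact mul_le_mul_of_nonneg_left
          (Real.rpow_le_rpow (Nat.cast_nonneg _) hcard (sub_nonneg.2 hβ)) zero_le_four

theorem sum_norm_lacunarySum_sq_le {p : ℕ → ℕ} {r s a A B n k : ℕ} {t : ℤ} {β : ℝ} (η : ℝ)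
    (hp : p s ≠ 0) (hps : p s ≤ s) (hs : 2 ≤ s) (hr : 2 ≤ r) (hβ : β ≤ 1)
    (hsine : SineBound p r s β) (ht : t ≠ 0) (hA : s ^ a ≤ s * r ^ A)
    (hB : r ^ B ≤ r * s ^ (a + 2 + n)) (hk : 32 * t.natAbs * s ^ 2 ≤ 2 ^ k) :
    ∑ c : Fin n → Fin (p s), ‖lacunarySum r A B t (digitPoint s η a c)‖ ^ 2 ≤
      (p s : ℝ) ^ n * (4 * k * ((B - A : ℕ) : ℝ) + 8 * ((B - A : ℕ) : ℝ) ^ (2 - β)) := by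
  set R : ℕ := B - A
  set ω : ℕ → ℝ := fun x => (r : ℝ) ^ (A + x) * t
  set g : ℕ → ℕ → ℝ := fun x y =>
    ∏ i ∈ range n, sineRatio (p s) ((ω x - ω y) / (s : ℝ) ^ (a + 1 + i))
  have hpairs : ∑ x ∈ range R, ∑ y ∈ range R, g x y ≤
      4 * k * R + 2 * R * (4 * (R : ℝ) ^ (1 - β)) :=
    sum_sum_le_of_diagonals (fun x y => prod_nonneg fun _ _ => sineRatio_nonneg _ _)
      (fun x y => prod_le_one (fun _ _ => sineRatio_nonneg _ _) fun _ _ => sineRatio_le_one _ _)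
      (fun x y => prod_congr rfl fun i _ => by rw [← sineRatio_neg, ← neg_div, neg_sub])
      (by positivity) fun d hd => sum_diagonal_le hp hps hs hr hβ hsine ht hA hB hk hd
  calc ∑ c : Fin n → Fin (p s), ‖lacunarySum r A B t (digitPoint s η a c)‖ ^ 2
      ≤ ∑ x ∈ range R, ∑ y ∈ range R,
          ‖∑ c : Fin n → Fin (p s), e ((ω x - ω y) * digitPoint s η a c)‖ := by
        simp only [lacunarySum_eq_sum_range]
        exact sum_norm_sum_e_sq_le _ ω _
    _ = (p s : ℝ) ^ n * ∑ x ∈ range R, ∑ y ∈ range R, g x y := by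
        simp only [norm_sum_e_digitPoint, mul_sum, g]
    _ ≤ (p s : ℝ) ^ n * (4 * k * R + 2 * R * (4 * (R : ℝ) ^ (1 - β))) := by gcongr
    _ = (p s : ℝ) ^ n * (4 * k * R + 8 * (R : ℝ) ^ (2 - β)) := by
        rw [show 2 - β = 1 + (1 - β) by ring,
          Real.rpow_one_add' (Nat.cast_nonneg R) (by linarith)]
        ring

/-! ### Low discrepancy strings -/

theorem IsLowDiscrepancy.mono {b : ℕ} {C : ℝ} {N N' : ℕ∞} {w : List (Fin b)} (hN : N ≤ N')
    (h : IsLowDiscrepancy C N w) : IsLowDiscrepancy C N' w := fun z n hz hn hlen =>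
  h z n ((add_le_add_right hN _).trans hz) (hN.trans hn) hlen

theorem exists_isThreshold_of_leastThreshold_le {b : ℕ} {C ε : ℝ} {N : ℕ∞} (hN : N ≠ ⊤)
    (h : leastThreshold b C ε ≤ N) : ∃ M : ℕ, (M : ℕ∞) ≤ N ∧ IsThreshold b C ε M := by
  rw [← ENat.lt_add_one_iff hN, leastThreshold] at h
  obtain ⟨M, hM⟩ := iInf_lt_iff.1 h
  obtain ⟨hthreshold, hlt⟩ := iInf_lt_iff.1 hM
  exact ⟨M, (ENat.lt_add_one_iff hN).1 hlt, hthreshold⟩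

/-- If the whole string has length at most `N`, only the empty string `z` and `n = |w|` enter the
definition of low discrepancy. -/
theorem IsLowDiscrepancy.congr_of_length_le {b : ℕ} {C : ℝ} {N : ℕ∞} {w w' : List (Fin b)}
    (h : IsLowDiscrepancy C N w) (hlen : w.length = w'.length) (hN : (w.length : ℕ∞) ≤ N) :
    IsLowDiscrepancy C N w' := by
  intro z n hz hn hnz
  rw [← hlen] at hz hnz
  have hwn : w.length ≤ n := by exact_mod_cast hN.trans hn
  obtain rfl : z = [] := List.length_eq_zero_iff.1 (by omega)
  have hw := h [] n hz hn hnz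
  rw [List.take_of_length_le hwn] at hw
  rw [List.take_of_length_le (hlen ▸ hwn)]
  simpa [occurrenceCount, hlen] using hw

open Classical in
theorem le_card_isLowDiscrepancy {q n : ℕ} {C ε : ℝ} {N : ℕ∞} (hε : 0 ≤ ε)
    (hN : leastThreshold q C ε ≤ N)
    (hex : ∃ c : Fin n → Fin q, IsLowDiscrepancy C N (List.ofFn c)) :
    (1 - ε) * (q : ℝ) ^ n ≤
      #{c : Fin n → Fin q | IsLowDiscrepancy C N (List.ofFn c)} := by
  have hcompl : (#{c : Fin n → Fin q | IsLowDiscrepancy C N (List.ofFn c)} : ℝ) +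
      #{c : Fin n → Fin q | ¬ IsLowDiscrepancy C N (List.ofFn c)} = (q : ℝ) ^ n := by
    rw [← Nat.cast_add, card_filter_add_card_filter_not]
    simp only [card_univ, Fintype.card_fun, Fintype.card_fin, Nat.cast_pow]
  suffices hbad : (#{c : Fin n → Fin q | ¬ IsLowDiscrepancy C N (List.ofFn c)} : ℝ) ≤
      ε * (q : ℝ) ^ n by linarith
  rcases le_or_gt (n : ℕ∞) N with hn | hn
  · obtain ⟨c₀, hc₀⟩ := hex
    rw [filter_false_of_mem fun c _ => not_not.2 <|
      hc₀.congr_of_length_le (by simp only [List.length_ofFn]) (by simpa using hn)]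
    simpa using by positivity
  · obtain ⟨M, hMN, hM⟩ := exists_isThreshold_of_leastThreshold_le hn.ne_top hN
    refine le_trans (Nat.cast_le.2 ?_) (hM n (by exact_mod_cast hMN.trans_lt hn))
    rw [← Set.ncard_coe_finset, coe_filter_univ]
    exact Set.ncard_le_ncard fun c hc hM => hc (hM.mono hMN)

theorem A_nonneg (u : ℕ → ℕ) (m : ℕ) (x : ℝ) : 0 ≤ A u m x :=
  sum_nonneg fun _ _ => sum_nonneg fun _ _ => by positivity

/-- The minimum of `A u m` over the low discrepancy strings is at most its mean over them. -/
theorem IsMinimalChoice.mul_A_le_sum {u : ℕ → ℕ} {C : ℕ → ℝ} {N : ℕ → ℕ∞} {m q : ℕ} {y x ε : ℝ}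
    (h : IsMinimalChoice u C N m y q x) (hε : 0 ≤ ε) (hN : leastThreshold q (C q) ε ≤ N q) :
    (1 - ε) * (q : ℝ) ^ (bIdx u m - aIdx u m - 2) * A u m x ≤
      ∑ c, A u m (sigmaPoint u m y q c) := by
  classical
  obtain ⟨c₀, hc₀, -, hmin⟩ := h
  calc (1 - ε) * (q : ℝ) ^ (bIdx u m - aIdx u m - 2) * A u m x
      ≤ #{c : Fin (bIdx u m - aIdx u m - 2) → Fin q |
          IsLowDiscrepancy (C q) (N q) (List.ofFn c)} * A u m x :=
        mul_le_mul_of_nonneg_right (le_card_isLowDiscrepancy hε hN ⟨c₀, hc₀⟩) (A_nonneg u m x)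
    _ ≤ ∑ c with IsLowDiscrepancy (C q) (N q) (List.ofFn c), A u m (sigmaPoint u m y q c) := by
        rw [← nsmul_eq_mul]
        exact card_nsmul_le_sum _ _ _ fun c hc => hmin c (mem_filter.1 hc).2
    _ ≤ ∑ c, A u m (sigmaPoint u m y q c) :=
        sum_le_sum_of_subset_of_nonneg (subset_univ _) fun _ _ _ => A_nonneg _ _ _

/-! ### Growth of the step lengths -/

/-- The length `⟨m + 1⟩ - ⟨m⟩` of the `m`-th step. -/
noncomputable def gap (u : ℕ → ℕ) (m : ℕ) : ℝ := (angle u (m + 1) : ℝ) - angle u m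

theorem sq_add_one_le_gap {u : ℕ → ℕ} (hu : 1 ≤ u 1) (m : ℕ) : (m : ℝ) ^ 2 + 1 ≤ gap u m := by
  have hu' : (1 : ℝ) ≤ u 1 := Nat.one_le_cast.2 hu
  have hcubic : (m : ℝ) ^ 2 + 2 ≤
      2 * (u 1 : ℝ) * ((m : ℝ) + 1) ^ 3 - 2 * (u 1 : ℝ) * (m : ℝ) ^ 3 := by
    nlinarith [(m.cast_nonneg : (0 : ℝ) ≤ m),
      mul_le_mul_of_nonneg_right hu' (by positivity : 0 ≤ 3 * (m : ℝ) ^ 2 + 3 * m + 1)]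
  have hexp : Real.exp √(m : ℝ) ≤ Real.exp √((m : ℝ) + 1) := by gcongr; linarith
  have hlower : Real.exp √((m : ℝ) + 1) + 2 * (u 1 : ℝ) * ((m : ℝ) + 1) ^ 3 ≤
      angle u (m + 1) := by
    rw [angle, if_neg m.succ_ne_zero]
    exact_mod_cast Nat.le_ceil _
  have hupper : (angle u m : ℝ) ≤ Real.exp √(m : ℝ) + 2 * (u 1 : ℝ) * (m : ℝ) ^ 3 + 1 := by
    rw [angle]
    split_ifs
    · rw [Nat.cast_zero]
      positivity
    · exact (Nat.ceil_lt_add_one (by positivity)).le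
  rw [gap]
  linarith

theorem one_le_gap {u : ℕ → ℕ} (hu : 1 ≤ u 1) (m : ℕ) : 1 ≤ gap u m :=
  (le_add_of_nonneg_left (sq_nonneg _)).trans (sq_add_one_le_gap hu m)

theorem sq_le_gap_rpow {u : ℕ → ℕ} (hu : 1 ≤ u 1) (m : ℕ) {β : ℝ} (hβ : β ≤ 1) :
    (m : ℝ) ^ 2 ≤ gap u m ^ (2 - β) :=
  calc (m : ℝ) ^ 2 ≤ gap u m ^ (1 : ℝ) := by
        rw [Real.rpow_one]
        exact (le_add_of_nonneg_right zero_le_one).trans (sq_add_one_le_gap hu m)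
    _ ≤ gap u m ^ (2 - β) := Real.rpow_le_rpow_of_exponent_le (one_le_gap hu m) (by linarith)

theorem mul_gap_le_gap_rpow {u : ℕ → ℕ} (hu : 1 ≤ u 1) (m : ℕ) {β : ℝ} (hβ : β ≤ 1 / 2) :
    m * gap u m ≤ gap u m ^ (2 - β) := by
  have hgap : 1 ≤ gap u m := one_le_gap hu m
  have hm : (m : ℝ) ≤ gap u m ^ (1 - β) :=
    calc (m : ℝ) ≤ √(gap u m) :=
          Real.le_sqrt_of_sq_le (by linarith [sq_add_one_le_gap hu m])
      _ = gap u m ^ (1 / 2 : ℝ) := Real.sqrt_eq_rpow _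
      _ ≤ gap u m ^ (1 - β) := Real.rpow_le_rpow_of_exponent_le hgap (by linarith)
  calc m * gap u m ≤ gap u m ^ (1 - β) * gap u m := by gcongr
    _ = gap u m ^ (2 - β) := by
        rw [show 2 - β = 1 - β + 1 by ring, Real.rpow_add_one (by positivity)]

theorem exp_angle_le_pow (u : ℕ → ℕ) (m : ℕ) {r : ℕ} (hr : 2 ≤ r) :
    Real.exp (angle u m) ≤ (r : ℝ) ^ angleBase u m r := by
  have hlog : 0 < Real.log r := Real.log_pos (by exact_mod_cast hr)
  rw [← Real.le_log_iff_exp_le (by positivity), Real.log_pow, ← div_le_iff₀ hlog]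
  exact Nat.le_ceil _

theorem pow_angleBase_le (u : ℕ → ℕ) (m : ℕ) {r : ℕ} (hr : 2 ≤ r) :
    (r : ℝ) ^ angleBase u m r ≤ r * Real.exp (angle u m) := by
  have hlog : 0 < Real.log r := Real.log_pos (by exact_mod_cast hr)
  have hceil : (angleBase u m r : ℝ) ≤ angle u m / Real.log r + 1 :=
    (Nat.ceil_lt_add_one (by positivity)).le
  rw [← Real.log_le_log_iff (by positivity) (by positivity), Real.log_pow,
    Real.log_mul (by positivity) (by positivity), Real.log_exp]
  calc angleBase u m r * Real.log r ≤ (angle u m / Real.log r + 1) * Real.log r := by gcongr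
    _ = Real.log r + angle u m := by field_simp; ring

theorem pow_angleBase_le_mul_pow_angleBase (u : ℕ → ℕ) (m : ℕ) {r s : ℕ} (hr : 2 ≤ r)
    (hs : 2 ≤ s) : r ^ angleBase u m r ≤ r * s ^ angleBase u m s := by
  have hreal : (r : ℝ) ^ angleBase u m r ≤ r * (s : ℝ) ^ angleBase u m s :=
    (pow_angleBase_le u m hr).trans <|
      mul_le_mul_of_nonneg_left (exp_angle_le_pow u m hs) r.cast_nonneg
  exact_mod_cast hreal

theorem angleBase_succ_sub_le {u : ℕ → ℕ} (hu : 1 ≤ u 1) (m : ℕ) {r : ℕ} (hr : 2 ≤ r) :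
    ((angleBase u (m + 1) r - angleBase u m r : ℕ) : ℝ) ≤ 3 * gap u m := by
  have hgap : 1 ≤ gap u m := one_le_gap hu m
  have hlog : 1 / 2 ≤ Real.log r := by
    have hlog₂ : Real.log 2 ≤ Real.log r := Real.log_le_log two_pos (by exact_mod_cast hr)
    linarith [Real.log_two_gt_d9]
  have hupper : (angleBase u (m + 1) r : ℝ) < angle u (m + 1) / Real.log r + 1 :=
    Nat.ceil_lt_add_one (by positivity)
  have hlower : (angle u m : ℝ) / Real.log r ≤ angleBase u m r := Nat.le_ceil _
  have hdiv : (angle u (m + 1) : ℝ) / Real.log r - angle u m / Real.log r ≤ 2 * gap u m := by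
    rw [← sub_div, ← gap, div_le_iff₀ (by linarith)]
    nlinarith
  rcases le_total (angleBase u (m + 1) r) (angleBase u m r) with h | h
  · rw [Nat.sub_eq_zero_of_le h, Nat.cast_zero]
    positivity
  · rw [Nat.cast_sub h]
    linarith

/-! ### Convergence -/

theorem sum_digit_div_pow_le {s q : ℕ} (hs : 1 ≤ s) (hqs : q ≤ s) (a n : ℕ) (c : Fin n → Fin q) :
    ∑ k, ((c k : ℕ) : ℝ) / (s : ℝ) ^ (a + 1 + (k : ℕ)) ≤ 1 / (s : ℝ) ^ a := by
  have hdigit : ∀ k : Fin n, ((c k : ℕ) : ℝ) / (s : ℝ) ^ (a + 1 + (k : ℕ)) ≤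
      1 / (s : ℝ) ^ (a + k) - 1 / (s : ℝ) ^ (a + (k + 1)) := fun k => by
    have hck : ((c k : ℕ) : ℝ) + 1 ≤ s := by exact_mod_cast (Nat.succ_le_of_lt (c k).2).trans hqs
    calc ((c k : ℕ) : ℝ) / (s : ℝ) ^ (a + 1 + (k : ℕ)) ≤ (s - 1) / (s : ℝ) ^ (a + 1 + (k : ℕ)) := by
          gcongr
          linarith
      _ = 1 / (s : ℝ) ^ (a + k) - 1 / (s : ℝ) ^ (a + (k + 1)) := by
          field_simp
          ring
  calc ∑ k, ((c k : ℕ) : ℝ) / (s : ℝ) ^ (a + 1 + (k : ℕ))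
      ≤ ∑ k : Fin n, (1 / (s : ℝ) ^ (a + k) - 1 / (s : ℝ) ^ (a + (k + 1))) :=
        sum_le_sum fun k _ => hdigit k
    _ = 1 / (s : ℝ) ^ a - 1 / (s : ℝ) ^ (a + n) := by
        rw [Fin.sum_univ_eq_sum_range fun k => 1 / (s : ℝ) ^ (a + k) - 1 / (s : ℝ) ^ (a + (k + 1)),
          sum_range_sub', add_zero]
    _ ≤ 1 / (s : ℝ) ^ a := sub_le_self _ (by positivity)

theorem IsMinimalChoice.mem_Icc {u : ℕ → ℕ} {C : ℕ → ℝ} {N : ℕ → ℕ∞} {m q : ℕ} {y x : ℝ}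
    (h : IsMinimalChoice u C N m y q x) (hu : 2 ≤ u m) (hq : q ≤ u m) (hy : 0 ≤ y) :
    x ∈ Set.Icc y (y + 2 * Real.exp (-angle u m)) := by
  obtain ⟨c, -, rfl, -⟩ := h
  have hs : (0 : ℝ) < (u m : ℝ) ^ aIdx u m := by positivity
  have hsum_nonneg : 0 ≤ ∑ k, ((c k : ℕ) : ℝ) / (u m : ℝ) ^ (aIdx u m + 1 + (k : ℕ)) :=
    sum_nonneg fun _ _ => by positivity
  have hsum_le := sum_digit_div_pow_le (one_le_two.trans hu) hq (aIdx u m) _ c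
  have hle_eta : y ≤ eta u m y := (le_div_iff₀ hs).2 (Nat.le_ceil _)
  have heta_le : eta u m y ≤ y + 1 / (u m : ℝ) ^ aIdx u m := by
    rw [eta, div_le_iff₀ hs, add_mul, one_div_mul_cancel hs.ne']
    exact (Nat.ceil_lt_add_one (by positivity)).le
  have hscale : 1 / (u m : ℝ) ^ aIdx u m ≤ Real.exp (-angle u m) := by
    rw [Real.exp_neg, ← one_div]
    exact one_div_le_one_div_of_le (Real.exp_pos _) (exp_angle_le_pow u m hu)
  rw [sigmaPoint]
  constructor <;> linarith

theorem two_mul_exp_neg_angle_succ_le {u : ℕ → ℕ} (hu : 1 ≤ u 1) (m : ℕ) :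
    2 * Real.exp (-angle u (m + 1)) ≤ Real.exp (-angle u m) :=
  calc 2 * Real.exp (-angle u (m + 1))
      ≤ Real.exp (gap u m) * Real.exp (-angle u (m + 1)) := by
        gcongr
        linarith [one_le_gap hu m, Real.add_one_le_exp (gap u m)]
    _ = Real.exp (-angle u m) := by
        rw [← Real.exp_add, gap]
        ring_nf

theorem exists_tendsto_of_mem_Icc_add {ξ δ : ℕ → ℝ}
    (hξ : ∀ m, ξ (m + 1) ∈ Set.Icc (ξ m) (ξ m + δ m)) (hδ : ∀ m, 2 * δ (m + 1) ≤ δ m) :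
    ∃ x, Tendsto ξ atTop (𝓝 x) ∧ ∀ m, x ∈ Set.Icc (ξ m) (ξ m + 2 * δ m) := by
  have hmono : Monotone ξ := monotone_nat_of_le_succ fun m => (hξ m).1
  have hanti : Antitone fun m => ξ m + 2 * δ m :=
    antitone_nat_of_succ_le fun m => by linarith [(hξ m).2, hδ m]
  have hle : ∀ m, ξ m ≤ ξ m + 2 * δ m := fun m => by linarith [(hξ m).1, (hξ m).2]
  have hbdd : BddAbove (Set.range ξ) :=
    ⟨ξ 0 + 2 * δ 0, Set.forall_mem_range.2 fun m => (hle m).trans (hanti (Nat.zero_le m))⟩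
  exact ⟨_, tendsto_atTop_ciSup hmono hbdd,
    Set.mem_iInter.1 (hmono.ciSup_mem_iInter_Icc_of_antitone hanti hle)⟩

/-! ### Bounds for `A` -/

open Classical in
/-- The pairs `(t, h)` over which the sum defining `A u m` extends. -/
noncomputable def frequencies (u : ℕ → ℕ) (m : ℕ) : Finset (ℤ × ℕ) :=
  {t ∈ Icc (-(m : ℤ)) m | t ≠ 0} ×ˢ {h ∈ Icc 1 m | ¬ BaseEquiv (u h) (u m)}

theorem mem_frequencies {u : ℕ → ℕ} {m : ℕ} {i : ℤ × ℕ} :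
    i ∈ frequencies u m ↔ (i.1.natAbs ≤ m ∧ i.1 ≠ 0) ∧
      (1 ≤ i.2 ∧ i.2 ≤ m) ∧ ¬ BaseEquiv (u i.2) (u m) := by
  simp only [frequencies, mem_product, mem_filter, mem_Icc, ← abs_le, Int.abs_eq_natAbs,
    Nat.cast_le]

theorem A_eq_sum_frequencies (u : ℕ → ℕ) (m : ℕ) (x : ℝ) :
    A u m x = ∑ i ∈ frequencies u m,
      ‖lacunarySum (u i.2) (angleBase u m (u i.2)) (angleBase u (m + 1) (u i.2)) i.1 x‖ ^ 2 := by
  rw [frequencies, sum_product]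
  rfl

open Classical in
theorem card_frequencies_le (u : ℕ → ℕ) (m : ℕ) : (#(frequencies u m) : ℝ) ≤ 2 * (m : ℝ) ^ 2 := by
  have ht : #{t ∈ Icc (-(m : ℤ)) m | t ≠ 0} = 2 * m := by
    rw [filter_ne', card_erase_of_mem (by simp), Int.card_Icc]
    omega
  have hcard : #(frequencies u m) ≤ 2 * m * m := by
    rw [frequencies, card_product, ht]
    gcongr
    exact (card_filter_le _ _).trans_eq (Nat.card_Icc 1 m)
  calc (#(frequencies u m) : ℝ) ≤ 2 * m * m := by exact_mod_cast hcard
    _ = 2 * (m : ℝ) ^ 2 := by ring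

theorem sum_frequencies_le {u : ℕ → ℕ} {m : ℕ} {f : ℤ × ℕ → ℝ} {B : ℝ} (hB : 0 ≤ B)
    (hf : ∀ i ∈ frequencies u m, f i ≤ B) : ∑ i ∈ frequencies u m, f i ≤ 2 * (m : ℝ) ^ 2 * B := by
  refine (sum_le_card_nsmul _ _ B hf).trans ?_
  rw [nsmul_eq_mul]
  exact mul_le_mul_of_nonneg_right (card_frequencies_le u m) hB

theorem mul_sum_Icc_pow_le {r : ℕ} (hr : 2 ≤ r) (A B : ℕ) :
    r * ∑ j ∈ Icc (A + 1) B, (r : ℝ) ^ (j - 1) ≤ 2 * (r : ℝ) ^ B := by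
  have hr' : (2 : ℝ) ≤ r := by exact_mod_cast hr
  have hsum : ∑ j ∈ Icc (A + 1) B, (r : ℝ) ^ (j - 1) ≤ ∑ i ∈ range B, (r : ℝ) ^ i := by
    have hzero := sum_Icc_succ_eq_sum_range (fun i => (r : ℝ) ^ i) 0 B
    simp only [zero_add, Nat.sub_zero] at hzero
    rw [← hzero]
    exact sum_le_sum_of_subset_of_nonneg (Icc_subset_Icc_left (by omega))
      fun _ _ _ => by positivity
  have hgeom : (∑ i ∈ range B, (r : ℝ) ^ i) * (r - 1) = (r : ℝ) ^ B - 1 := geom_sum_mul _ _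
  have hnonneg : 0 ≤ ∑ i ∈ range B, (r : ℝ) ^ i := by positivity
  nlinarith

theorem norm_lacunarySum_sub_le {u : ℕ → ℕ} {m r : ℕ} (hr : 2 ≤ r) (A : ℕ) {t : ℤ} {x z : ℝ}
    (ht : t.natAbs ≤ m) (hxz : |x - z| ≤ 4 * Real.exp (-angle u (m + 1))) :
    ‖lacunarySum r A (angleBase u (m + 1) r) t x - lacunarySum r A (angleBase u (m + 1) r) t z‖ ≤
      16 * π * m := by
  have ht' : |(t : ℝ)| ≤ m := by
    rw [← Int.cast_abs, Int.abs_eq_natAbs]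
    exact_mod_cast ht
  set B : ℕ := angleBase u (m + 1) r
  have hgeom : ∑ j ∈ Icc (A + 1) B, (r : ℝ) ^ (j - 1) ≤ 2 * Real.exp (angle u (m + 1)) := by
    refine le_of_mul_le_mul_left ?_ (by positivity : (0 : ℝ) < r)
    linarith [mul_sum_Icc_pow_le hr A B, pow_angleBase_le u (m + 1) hr]
  calc ‖lacunarySum r A B t x - lacunarySum r A B t z‖
      ≤ ∑ j ∈ Icc (A + 1) B, 2 * π * ((r : ℝ) ^ (j - 1) * |(t : ℝ)| * |x - z|) := by
        rw [lacunarySum, lacunarySum, ← sum_sub_distrib]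
        refine norm_sum_le_of_le _ fun j _ => (norm_e_sub_e_le _ _).trans_eq ?_
        rw [← mul_sub, abs_mul, abs_mul, abs_pow, Nat.abs_cast]
    _ = 2 * π * |(t : ℝ)| * |x - z| * ∑ j ∈ Icc (A + 1) B, (r : ℝ) ^ (j - 1) := by
        rw [mul_sum]
        exact sum_congr rfl fun j _ => by ring
    _ ≤ 2 * π * m * (4 * Real.exp (-angle u (m + 1))) * (2 * Real.exp (angle u (m + 1))) := by
        gcongr
    _ = 16 * π * m * (Real.exp (-angle u (m + 1)) * Real.exp (angle u (m + 1))) := by ring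
    _ = 16 * π * m := by rw [← Real.exp_add, neg_add_cancel, Real.exp_zero, mul_one]

theorem A_le_two_mul_A_add {u : ℕ → ℕ} {m : ℕ} (hu : ∀ k, 1 ≤ k → 2 ≤ u k) {x z : ℝ}
    (hxz : |x - z| ≤ 4 * Real.exp (-angle u (m + 1))) :
    A u m x ≤ 2 * A u m z + 4 * (16 * π) ^ 2 * (m : ℝ) ^ 2 * (m : ℝ) ^ 2 := by
  set S : ℤ × ℕ → ℝ → ℂ := fun i =>
    lacunarySum (u i.2) (angleBase u m (u i.2)) (angleBase u (m + 1) (u i.2)) i.1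
  have hterm : ∀ i ∈ frequencies u m, ‖S i x‖ ^ 2 - 2 * ‖S i z‖ ^ 2 ≤ 2 * (16 * π * m) ^ 2 :=
    fun i hi => by
      obtain ⟨⟨ht, -⟩, ⟨hh, -⟩, -⟩ := mem_frequencies.1 hi
      have hclose : ‖S i x - S i z‖ ≤ 16 * π * m := norm_lacunarySum_sub_le (hu _ hh) _ ht hxz
      have htriangle : ‖S i x‖ ≤ ‖S i z‖ + 16 * π * m := by
        linarith [norm_sub_norm_le (S i x) (S i z)]
      rw [sub_le_iff_le_add', ← mul_add]
      exact (pow_le_pow_left₀ (norm_nonneg _) htriangle 2).trans add_sq_le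
  rw [← sub_le_iff_le_add', A_eq_sum_frequencies, A_eq_sum_frequencies, mul_sum, ← sum_sub_distrib]
  refine (sum_frequencies_le (by positivity) hterm).trans_eq ?_
  ring

theorem mul_sq_le_two_pow {c m s t : ℕ} (hs : s ≤ 2 ^ (c * m)) (ht : t ≤ m) :
    32 * t * s ^ 2 ≤ 2 ^ (5 + (2 * c + 1) * m) :=
  calc 32 * t * s ^ 2 ≤ 2 ^ 5 * 2 ^ m * (2 ^ (c * m)) ^ 2 := by
        gcongr
        · norm_num
        · exact ht.trans Nat.lt_two_pow_self.le
    _ = 2 ^ (5 + (2 * c + 1) * m) := by ring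

theorem mean_square_bound_le {u : ℕ → ℕ} (hu : 1 ≤ u 1) {m : ℕ} (hm : 1 ≤ m) (c : ℕ) {R β : ℝ}
    (hR : 0 ≤ R) (hRgap : R ≤ 3 * gap u m) (hβ0 : 0 ≤ β) (hβ : β ≤ 1 / 2) :
    4 * ((5 + (2 * c + 1) * m : ℕ) : ℝ) * R + 8 * R ^ (2 - β) ≤
      (144 + 24 * c) * gap u m ^ (2 - β) := by
  have hm' : (1 : ℝ) ≤ m := Nat.one_le_cast.2 hm
  have hgap : 0 ≤ gap u m := zero_le_one.trans (one_le_gap hu m)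
  have hlinear : 4 * ((5 + (2 * c + 1) * m : ℕ) : ℝ) * R ≤ (72 + 24 * c) * gap u m ^ (2 - β) :=
    calc 4 * ((5 + (2 * c + 1) * m : ℕ) : ℝ) * R
        ≤ 4 * ((6 + 2 * c) * m) * (3 * gap u m) := by
          gcongr
          push_cast
          linarith
      _ = (72 + 24 * c) * (m * gap u m) := by ring
      _ ≤ (72 + 24 * c) * gap u m ^ (2 - β) := by
          gcongr
          exact mul_gap_le_gap_rpow hu m hβ
  have hpower : R ^ (2 - β) ≤ 9 * gap u m ^ (2 - β) :=
    calc R ^ (2 - β) ≤ (3 * gap u m) ^ (2 - β) := by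
          gcongr
          linarith
      _ = 3 ^ (2 - β) * gap u m ^ (2 - β) := Real.mul_rpow zero_le_three hgap
      _ ≤ 3 ^ (2 : ℝ) * gap u m ^ (2 - β) := by
          gcongr
          · norm_num
          · linarith
      _ = 9 * gap u m ^ (2 - β) := by norm_num
  linarith

theorem sum_A_sigmaPoint_le {p u : ℕ → ℕ} {c m : ℕ} {β : ℝ} (hm : 1 ≤ m)
    (hu : ∀ k, 1 ≤ k → 2 ≤ u k) (hum : u m ≤ 2 ^ (c * m)) (hp : p (u m) ≠ 0)
    (hpu : p (u m) ≤ u m) (hβ0 : 0 ≤ β) (hβ : β ≤ 1 / 2)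
    (hsine : ∀ k, 1 ≤ k → k ≤ m → ¬ BaseEquiv (u k) (u m) → SineBound p (u k) (u m) β) (y : ℝ) :
    ∑ d, A u m (sigmaPoint u m y (p (u m)) d) ≤
      (p (u m) : ℝ) ^ (bIdx u m - aIdx u m - 2) *
        (2 * (m : ℝ) ^ 2 * ((144 + 24 * c) * gap u m ^ (2 - β))) := by
  have hu1 : 1 ≤ u 1 := one_le_two.trans (hu 1 le_rfl)
  have hgap : 0 ≤ gap u m := zero_le_one.trans (one_le_gap hu1 m)
  have hterm : ∀ i ∈ frequencies u m,
      ∑ d, ‖lacunarySum (u i.2) (angleBase u m (u i.2)) (angleBase u (m + 1) (u i.2)) i.1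
          (sigmaPoint u m y (p (u m)) d)‖ ^ 2 ≤
        (p (u m) : ℝ) ^ (bIdx u m - aIdx u m - 2) * ((144 + 24 * c) * gap u m ^ (2 - β)) :=
    fun i hi => by
      obtain ⟨⟨ht, ht0⟩, ⟨hh, hhm⟩, hequiv⟩ := mem_frequencies.1 hi
      have hbase := hu _ hh
      refine (sum_norm_lacunarySum_sq_le (eta u m y) hp hpu (hu m hm) hbase (by linarith)
        (hsine _ hh hhm hequiv) ht0 (pow_angleBase_le_mul_pow_angleBase u m (hu m hm) hbase) ?_
        (mul_sq_le_two_pow hum ht)).trans ?_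
      · refine (pow_angleBase_le_mul_pow_angleBase u (m + 1) hbase (hu m hm)).trans ?_
        gcongr
        · exact one_le_two.trans (hu m hm)
        · change bIdx u m ≤ aIdx u m + 2 + (bIdx u m - aIdx u m - 2)
          omega
      · gcongr
        exact mean_square_bound_le hu1 hm c (Nat.cast_nonneg _)
          (angleBase_succ_sub_le hu1 m hbase) hβ0 hβ
  simp only [A_eq_sum_frequencies]
  rw [sum_comm]
  refine (sum_frequencies_le (by positivity) hterm).trans_eq ?_
  ring

theorem IsMinimalChoice.A_le {p u : ℕ → ℕ} {C : ℕ → ℝ} {N : ℕ → ℕ∞} {c m : ℕ} {y x ε β : ℝ}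
    (h : IsMinimalChoice u C N m y (p (u m)) x) (hε0 : 0 ≤ ε) (hε : ε < 1)
    (hN : leastThreshold (p (u m)) (C (p (u m))) ε ≤ N (p (u m))) (hm : 1 ≤ m)
    (hu : ∀ k, 1 ≤ k → 2 ≤ u k) (hum : u m ≤ 2 ^ (c * m)) (hp : p (u m) ≠ 0)
    (hpu : p (u m) ≤ u m) (hβ0 : 0 ≤ β) (hβ : β ≤ 1 / 2)
    (hsine : ∀ k, 1 ≤ k → k ≤ m → ¬ BaseEquiv (u k) (u m) → SineBound p (u k) (u m) β) :
    A u m x ≤ 2 * (m : ℝ) ^ 2 * ((144 + 24 * c) * gap u m ^ (2 - β)) / (1 - ε) := by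
  have hpos : 0 < (p (u m) : ℝ) ^ (bIdx u m - aIdx u m - 2) := by positivity
  rw [le_div_iff₀ (sub_pos.2 hε)]
  refine le_of_mul_le_mul_left ?_ hpos
  calc (p (u m) : ℝ) ^ (bIdx u m - aIdx u m - 2) * (A u m x * (1 - ε))
      = (1 - ε) * (p (u m) : ℝ) ^ (bIdx u m - aIdx u m - 2) * A u m x := by ring
    _ ≤ ∑ d, A u m (sigmaPoint u m y (p (u m)) d) := h.mul_A_le_sum hε0 hN
    _ ≤ _ := sum_A_sigmaPoint_le hm hu hum hp hpu hβ0 hβ hsine y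

/-! ### Sequences chosen by the two criteria -/

theorem exists_tendsto_of_isMinimalChoice {u q : ℕ → ℕ} {C : ℕ → ℝ} {N : ℕ → ℕ∞} {ξ : ℕ → ℝ}
    (hu : ∀ m, 1 ≤ m → 2 ≤ u m) (hq : ∀ m, 1 ≤ m → q m ≤ u m) (h0 : 0 ≤ ξ 0)
    (hξ : ∀ m, 1 ≤ m → IsMinimalChoice u C N m (ξ (m - 1)) (q m) (ξ m)) :
    ∃ x, Tendsto ξ atTop (𝓝 x) ∧ ∀ m, |x - ξ m| ≤ 4 * Real.exp (-angle u (m + 1)) := by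
  have hstep : ∀ m, 0 ≤ ξ m →
      ξ (m + 1) ∈ Set.Icc (ξ m) (ξ m + 2 * Real.exp (-angle u (m + 1))) := fun m hm =>
    (hξ (m + 1) m.succ_pos).mem_Icc (hu _ m.succ_pos) (hq _ m.succ_pos) hm
  have hnonneg : ∀ m, 0 ≤ ξ m := fun m => by
    induction m with
    | zero => exact h0
    | succ m ih => exact ih.trans (hstep m ih).1
  obtain ⟨x, hx, hmem⟩ := exists_tendsto_of_mem_Icc_add (fun m => hstep m (hnonneg m)) fun m => by
    gcongr
    exact two_mul_exp_neg_angle_succ_le (one_le_two.trans (hu 1 le_rfl)) (m + 1)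
  refine ⟨x, hx, fun m => ?_⟩
  rw [abs_of_nonneg (sub_nonneg.2 (hmem m).1)]
  linarith [(hmem m).2]

/-- Criterion 2 is Criterion 1 for `p = id`, and for `p = id` the sine bound holds with every
exponent up to `1`, whatever the bases. -/
theorem exists_isMinimalChoice_sineBound {p u : ℕ → ℕ} {C : ℕ → ℝ} {N : ℕ → ℕ∞} {m : ℕ} {y x : ℝ}
    (hu : ∀ k, 1 ≤ k → 2 ≤ u k) (hm : 1 ≤ m) (hp : 1 ≤ p (u m) ∧ p (u m) ≤ u m)
    (h : Criterion1 p u C N m y x ∨ Criterion2 u C N m y x) :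
    ∃ p' : ℕ → ℕ, IsMinimalChoice u C N m y (p' (u m)) x ∧ 1 ≤ p' (u m) ∧ p' (u m) ≤ u m ∧
      ∀ k, 1 ≤ k → k ≤ m → ¬ BaseEquiv (u k) (u m) → SineBound p' (u k) (u m) (beta p u m) := by
  rcases h with h | h
  · exact ⟨p, h, hp.1, hp.2, fun k hk hkm => sineBound_beta p u hk hkm⟩
  · exact ⟨id, h, one_le_two.trans (hu m hm), le_rfl, fun k hk _ _ =>
      sineBound_id (hu k hk) (hu m hm) ((beta_le_half p u m).trans (by norm_num))⟩

theorem IsGoodSequence.le_two_pow {p u : ℕ → ℕ} {N : ℕ → ℕ∞} (h : IsGoodSequence p N u) {m : ℕ}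
    (hm : 1 ≤ m) : u m ≤ 2 ^ ((u 1 + 1) * m) :=
  calc u m ≤ u 1 * m := h.le_mul m hm
    _ ≤ (u 1 + 1) * m := by gcongr; exact Nat.le_succ _
    _ ≤ 2 ^ ((u 1 + 1) * m) := Nat.lt_two_pow_self.le

end SchmidtConstruction

open SchmidtConstruction

theorem mainTheorem3_general (c : ℕ) {ε : ℝ} (hε0 : 0 ≤ ε) (hε1 : ε < 1) :
    ∃ δ : ℝ, ∀ (p u : ℕ → ℕ) (C : ℕ → ℝ) (N : ℕ → ℕ∞) (ξ : ℕ → ℝ),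
      (∀ m, 1 ≤ m → 2 ≤ u m) →
      (∀ m, 1 ≤ m → u m ≤ 2 ^ (c * m)) →
      (∀ m, 1 ≤ m → 1 ≤ p (u m) ∧ p (u m) ≤ u m) →
      (∀ b, leastThreshold b (C b) ε ≤ N b) →
      0 ≤ ξ 0 →
      (∀ m, 1 ≤ m → Criterion1 p u C N m (ξ (m - 1)) (ξ m) ∨
        Criterion2 u C N m (ξ (m - 1)) (ξ m)) →
      ∃ x : ℝ, Filter.Tendsto ξ Filter.atTop (nhds x) ∧ ∀ m, 1 ≤ m →
        A u m x ≤ δ * (m : ℝ) ^ 2 * ((angle u (m + 1) : ℝ) - angle u m) ^ (2 - beta p u m) := by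
  refine ⟨4 * (144 + 24 * c) / (1 - ε) + 4 * (16 * Real.pi) ^ 2,
    fun p u C N ξ hu hgrowth hp hN h0 hξ => ?_⟩
  choose! P hmin hPpos hPle hsine using fun m hm =>
    exists_isMinimalChoice_sineBound hu hm (hp m hm) (hξ m hm)
  obtain ⟨x, hlim, hx⟩ := exists_tendsto_of_isMinimalChoice hu hPle h0 hmin
  refine ⟨x, hlim, fun m hm => ?_⟩
  have hξm := (hmin m hm).A_le hε0 hε1 (hN _) hm hu (hgrowth m hm)
    (Nat.one_le_iff_ne_zero.1 (hPpos m hm)) (hPle m hm) (beta_nonneg p u m) (beta_le_half p u m)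
    (hsine m hm)
  have hsq : (m : ℝ) ^ 2 ≤ gap u m ^ (2 - beta p u m) :=
    sq_le_gap_rpow (one_le_two.trans (hu 1 le_rfl)) m (by linarith [beta_le_half p u m])
  calc A u m x ≤ 2 * A u m (ξ m) + 4 * (16 * Real.pi) ^ 2 * (m : ℝ) ^ 2 * (m : ℝ) ^ 2 :=
        A_le_two_mul_A_add hu (hx m)
    _ ≤ 2 * (2 * (m : ℝ) ^ 2 * ((144 + 24 * c) * gap u m ^ (2 - beta p u m)) / (1 - ε)) +
        4 * (16 * Real.pi) ^ 2 * (m : ℝ) ^ 2 * gap u m ^ (2 - beta p u m) := by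
      gcongr
    _ = (4 * (144 + 24 * c) / (1 - ε) + 4 * (16 * Real.pi) ^ 2) * (m : ℝ) ^ 2 *
        gap u m ^ (2 - beta p u m) := by ring

theorem mainTheorem3 (u₁ : ℕ) :
    ∃ δ : ℝ, ∀ (p u : ℕ → ℕ) (C : ℕ → ℝ) (N : ℕ → ℕ∞) (ξ : ℕ → ℝ),
      u 1 = u₁ →
      (∀ m : ℕ, 1 ≤ m → 2 ≤ u m) →
      (∀ m : ℕ, 1 ≤ m → 1 ≤ p (u m) ∧ p (u m) ≤ u m) →
      (∀ b : ℕ, SchmidtConstruction.leastThreshold b (C b) (1 / 2) ≤ N b) →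
      SchmidtConstruction.IsGoodSequence p N u →
      ξ 0 = 0 →
      (∀ m : ℕ, 1 ≤ m →
        SchmidtConstruction.Criterion1 p u C N m (ξ (m - 1)) (ξ m) ∨
        SchmidtConstruction.Criterion2 u C N m (ξ (m - 1)) (ξ m)) →
      ∃ x : ℝ, Filter.Tendsto ξ Filter.atTop (nhds x) ∧
        ∀ m : ℕ, 1 ≤ m →
          SchmidtConstruction.A u m x ≤
            δ * (m : ℝ) ^ 2 *
              ((SchmidtConstruction.angle u (m + 1) : ℝ) - SchmidtConstruction.angle u m) ^
                (2 - SchmidtConstruction.beta p u m) := by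
  obtain ⟨δ, hδ⟩ := mainTheorem3_general (u₁ + 1) one_half_pos.le one_half_lt_one
  exact ⟨δ, fun p u C N ξ hu₁ hu hp hN hgood h0 => hδ p u C N ξ hu
    (fun m hm => hu₁ ▸ hgood.le_two_pow hm) hp hN h0.ge⟩
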